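/- Let $\alpha>1$. For a non-decreasing, bounded and uniformly continuous function $m_0:[0,\infty)\to\mathbb R$ with $m_0(0)=0$, consider the mass equation $$m_t+m\,(m_\rho)_+^{\alpha}=0\quad (t,\rho>0),\qquad m(t,0)=0\quad(t>0),\qquad m(0,\rho)=m_0(\rho)\quad(\rho>0).$$ A continuous function $m:[0,\infty)^2\to\mathbb R$ is a viscosity subsolution if $p_1+(p_2)_+^{\alpha}\,m(t,\rho)\le 0$ for all $t,\rho>0$ and all $(p_1,p_2)$ in the Fréchet superdifferential $D^+m(t,\rho)$, $m(0,\rho)\le m_0(\rho)$ and $m(t,0)\le 0$; it is a viscosity supersolution if $p_1+(p_2)_+^{\alpha}\,m(t,\rho)\ge 0$ for all $t,\rho>0$ and all $(p_1,p_2)$ in the Fréchet subdifferential $D^-m(t,\rho)$, $m(0,\rho)\ge m_0(\rho)$ and $m(t,0)\ge 0$; it is a viscosity solution if it is both. Let $M=\sup m_0$ be the total mass, let $u_0=(m_0)_\rho$ (in the sense of distributions), and assume that the support of $u_0$ in $[0,\infty)$ has a maximum $c_0=\max\operatorname{supp}u_0$. Let $m$ be the bounded and uniformly continuous viscosity solution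 on $[0,\infty)^2$ with initial datum $m_0$. If $$\limsup_{\rho\to c_0^-}\frac{M-m_0(\rho)}{(c_0-\rho)^{\frac{\alpha}{\alpha-1}}}=+\infty,$$ then there is no waiting time: for every $t>0$ the support of $u(t,\cdot)=m_\rho(t,\cdot)$ (derivative in the sense of distributions, support taken in $[0,\infty)$) has a maximum $S(t)$, and $S(t)>c_0$. -/

import Mathlib

open Set Filter Topology MeasureTheory
open scoped Distributions

noncomputable section

/-- Bounded and uniformly continuous on the set `s`. -/
def IsBUCOn {X : Type*} [UniformSpace X] (f : X → ℝ) (s : Set X) : Prop :=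
  UniformContinuousOn f s ∧ ∃ C : ℝ, ∀ x ∈ s, |f x| ≤ C

/-- The Fréchet subdifferential `D⁻ f (x)` at a point `x` interior to the domain of `f`. -/
def frechetSubdiff {n : ℕ} (f : EuclideanSpace ℝ (Fin n) → ℝ) (x : EuclideanSpace ℝ (Fin n)) :
    Set (EuclideanSpace ℝ (Fin n)) :=
  {p | 0 ≤ liminf (fun y => (((f y - f x - inner ℝ p (y - x)) / ‖y - x‖ : ℝ) : EReal)) (𝓝[≠] x)}

/-- The Fréchet superdifferential `D⁺ f (x)` at a point `x` interior to the domain of `f`. -/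
def frechetSuperdiff {n : ℕ} (f : EuclideanSpace ℝ (Fin n) → ℝ) (x : EuclideanSpace ℝ (Fin n)) :
    Set (EuclideanSpace ℝ (Fin n)) :=
  {p | limsup (fun y => (((f y - f x - inner ℝ p (y - x)) / ‖y - x‖ : ℝ) : EReal)) (𝓝[≠] x) ≤ 0}

/-- Viscosity subsolutions of `m_t + m (m_ρ)_+^α = 0` for `t, ρ > 0`, with `m(t, 0) = 0` and
`m(0, ρ) = m₀(ρ)`. Only the values of `m` on `[0, ∞)²` matter. -/
structure IsViscositySubsolution (α : ℝ) (m₀ : ℝ → ℝ) (m : ℝ → ℝ → ℝ) : Prop where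
  continuousOn : ContinuousOn (Function.uncurry m) (Ici 0 ×ˢ Ici 0)
  equation : ∀ t > 0, ∀ ρ > 0, ∀ p ∈ frechetSuperdiff (fun z => m (z 0) (z 1)) !₂[t, ρ],
    p 0 + (max (p 1) 0) ^ α * m t ρ ≤ 0
  initial : ∀ ρ > 0, m 0 ρ ≤ m₀ ρ
  boundary : ∀ t > 0, m t 0 ≤ 0

/-- Viscosity supersolutions of the same problem. -/
structure IsViscositySupersolution (α : ℝ) (m₀ : ℝ → ℝ) (m : ℝ → ℝ → ℝ) : Prop where
  continuousOn : ContinuousOn (Function.uncurry m) (Ici 0 ×ˢ Ici 0)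
  equation : ∀ t > 0, ∀ ρ > 0, ∀ p ∈ frechetSubdiff (fun z => m (z 0) (z 1)) !₂[t, ρ],
    0 ≤ p 0 + (max (p 1) 0) ^ α * m t ρ
  initial : ∀ ρ > 0, m₀ ρ ≤ m 0 ρ
  boundary : ∀ t > 0, 0 ≤ m t 0

/-- Viscosity solutions: both sub- and supersolutions. -/
def IsViscositySolution (α : ℝ) (m₀ : ℝ → ℝ) (m : ℝ → ℝ → ℝ) : Prop :=
  IsViscositySubsolution α m₀ m ∧ IsViscositySupersolution α m₀ m

/-- The open half-line `(0, ∞)`. -/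
def openHalfLine : TopologicalSpace.Opens ℝ := ⟨Ioi 0, isOpen_Ioi⟩

/-- The distributional derivative `u = f_ρ` on `(0, ∞)`, acting on test functions. -/
def distribDeriv (f : ℝ → ℝ) (φ : 𝓓(openHalfLine, ℝ)) : ℝ :=
  -∫ ρ in Ioi (0 : ℝ), f ρ * deriv (φ : ℝ → ℝ) ρ

/-- The support, as a closed subset of `[0, ∞)`, of the density `u = f_ρ` with mass function `f`,
the derivative being taken in the sense of distributions. -/
def densitySupport (f : ℝ → ℝ) : Set ℝ :=
  Distribution.dsupport (distribDeriv f)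

end

/-!
The front leaves `c₀` at once because `m` can be compared directly with explicit classical barriers;
no doubling of variables is needed, since the test function at a touching point is the barrier
itself, up to a small linear term `η (t + ρ)` that makes extrema on the unbounded quadrant attained
(`IsViscositySupersolution.ge_of_classical`, `IsViscositySubsolution.le_of_classical`).

* From above (`IsViscositySubsolution.le_hopfLax`): for `β = α / (α - 1)` and suitable `C`, the
  profile `b + C (t + ε) ^ (1 - β) (ρ - r)₊ ^ β` is a supersolution. It is the Hopf–Lax solution of
  the equation with the zeroth-order factor `m` frozen at a lower bound of `m₀ r`. If
  `M - m₀ r > C t ^ (1 - β) (c₀ - r) ^ β`, then choosing `b` slightly above `m₀ r` and `ε` small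
  gives `m t c₀ < M` (`lt_mass_of_large_gap`). The exponent `β` is the one in the hypothesis on the
  upper limit, which therefore provides such an `r < c₀` for every `t > 0`; taking `r` close to `c₀`
  keeps `m₀ r ≥ M / 2`, so that `C` does not depend on `r`.
* From below (`IsViscositySupersolution.mass_le_of_le`): a truncated parabola travelling at constant
  speed is a subsolution and forces `m t ρ = M` for large `ρ`, so the support at time `t` is bounded.

Thus `m t` is not constant on `[c₀, ∞)`. By the du Bois-Reymond lemma
(`exists_eq_const_of_isVanishingOn`) its distributional derivative has support in `(c₀, ∞)`, and a
closed, nonempty set that is bounded above has a maximum.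
-/

open scoped ContDiff

/-! ### Touching by differentiable functions -/

theorem mem_frechetSubdiff_of_isLocalMin_sub {f ψ : EuclideanSpace ℝ (Fin 2) → ℝ}
    {x p : EuclideanSpace ℝ (Fin 2)} (hmin : IsLocalMin (fun y => f y - ψ y) x)
    (hψ : HasFDerivAt ψ (innerSL ℝ p) x) : p ∈ frechetSubdiff f x := by
  have : (𝓝[≠] x).NeBot := Module.punctured_nhds_neBot ℝ _ x
  have h0 : Tendsto (fun y => -(‖y - x‖⁻¹ * ‖ψ y - ψ x - innerSL ℝ p (y - x)‖)) (𝓝[≠] x) (𝓝 0) := by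
    simpa using ((hasFDerivAt_iff_tendsto.1 hψ).neg).mono_left nhdsWithin_le_nhds
  have h1 := ((continuous_coe_real_ereal.tendsto (0 : ℝ)).comp h0).liminf_eq
  rw [frechetSubdiff, mem_ofPred_eq]
  refine h1.symm.le.trans (liminf_le_liminf ?_)
  filter_upwards [nhdsWithin_le_nhds hmin] with y hy
  have hy : f x - ψ x ≤ f y - ψ y := hy
  simp only [Function.comp, EReal.coe_le_coe_iff, innerSL_apply_apply]
  rw [← mul_neg, div_eq_inv_mul]
  refine mul_le_mul_of_nonneg_left ?_ (by positivity)
  have := neg_abs_le (ψ y - ψ x - inner ℝ p (y - x))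
  rw [Real.norm_eq_abs]
  linarith

theorem mem_frechetSuperdiff_of_isLocalMax_sub {f ψ : EuclideanSpace ℝ (Fin 2) → ℝ}
    {x p : EuclideanSpace ℝ (Fin 2)} (hmax : IsLocalMax (fun y => f y - ψ y) x)
    (hψ : HasFDerivAt ψ (innerSL ℝ p) x) : p ∈ frechetSuperdiff f x := by
  have : (𝓝[≠] x).NeBot := Module.punctured_nhds_neBot ℝ _ x
  have h0 : Tendsto (fun y => ‖y - x‖⁻¹ * ‖ψ y - ψ x - innerSL ℝ p (y - x)‖) (𝓝[≠] x) (𝓝 0) :=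
    (hasFDerivAt_iff_tendsto.1 hψ).mono_left nhdsWithin_le_nhds
  have h1 := ((continuous_coe_real_ereal.tendsto (0 : ℝ)).comp h0).limsup_eq
  rw [frechetSuperdiff, mem_ofPred_eq]
  refine (limsup_le_limsup ?_).trans h1.le
  filter_upwards [nhdsWithin_le_nhds hmax] with y hy
  have hy : f y - ψ y ≤ f x - ψ x := hy
  simp only [Function.comp, EReal.coe_le_coe_iff, innerSL_apply_apply]
  rw [div_eq_inv_mul]
  refine mul_le_mul_of_nonneg_left ?_ (by positivity)
  have := le_abs_self (ψ y - ψ x - inner ℝ p (y - x))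
  rw [Real.norm_eq_abs]
  linarith

/-! ### Comparison with classical sub- and supersolutions -/

/-- The linear penalty `η * (t + ρ)` confines minimising sequences on the unbounded quadrant. -/
theorem exists_interior_min_add_linear {f : ℝ → ℝ → ℝ}
    (hf : ContinuousOn (Function.uncurry f) (Ici 0 ×ˢ Ici 0)) {B : ℝ}
    (hB : ∀ t ≥ 0, ∀ ρ ≥ 0, B ≤ f t ρ) (hinit : ∀ ρ ≥ 0, 0 ≤ f 0 ρ) (hbdry : ∀ t ≥ 0, 0 ≤ f t 0)
    {t₀ ρ₀ : ℝ} (ht₀ : 0 ≤ t₀) (hρ₀ : 0 ≤ ρ₀) (hneg : f t₀ ρ₀ < 0) :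
    ∃ η > 0, ∃ t > 0, ∃ ρ > 0, f t ρ < 0 ∧
      ∀ s ≥ 0, ∀ σ ≥ 0, f t ρ + η * (t + ρ) ≤ f s σ + η * (s + σ) := by
  obtain ⟨η, hη, hv⟩ : ∃ η > 0, f t₀ ρ₀ + η * (t₀ + ρ₀) < 0 := by
    refine ⟨-f t₀ ρ₀ / (t₀ + ρ₀ + 1), by apply div_pos <;> linarith, ?_⟩
    have h : 0 < t₀ + ρ₀ + 1 := by linarith
    have : f t₀ ρ₀ + -f t₀ ρ₀ / (t₀ + ρ₀ + 1) * (t₀ + ρ₀) = f t₀ ρ₀ / (t₀ + ρ₀ + 1) := by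
      field_simp; ring
    rw [this]
    exact div_neg_of_neg_of_pos hneg h
  set L := |B| / η + t₀ + ρ₀
  have hBη : 0 ≤ |B| / η := by positivity
  have hηL : |B| ≤ η * L := by
    have : η * (|B| / η) = |B| := by field_simp
    nlinarith
  have hK : IsCompact (Icc 0 L ×ˢ Icc 0 L : Set (ℝ × ℝ)) := isCompact_Icc.prod isCompact_Icc
  have hmem : (t₀, ρ₀) ∈ (Icc 0 L ×ˢ Icc 0 L : Set (ℝ × ℝ)) :=
    ⟨⟨ht₀, by simp only [L]; linarith⟩, ⟨hρ₀, by simp only [L]; linarith⟩⟩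
  have hcont : ContinuousOn (fun z : ℝ × ℝ => f z.1 z.2 + η * (z.1 + z.2))
      (Icc 0 L ×ˢ Icc 0 L) :=
    ContinuousOn.add (hf.mono (prod_mono Icc_subset_Ici_self Icc_subset_Ici_self))
      (by fun_prop)
  obtain ⟨⟨t, ρ⟩, ⟨ht, hρ⟩, hmin⟩ := hK.exists_isMinOn ⟨_, hmem⟩ hcont
  simp only [mem_Icc] at ht hρ
  have h0 : f t ρ + η * (t + ρ) ≤ f t₀ ρ₀ + η * (t₀ + ρ₀) := hmin hmem
  have hp : 0 ≤ η * (t + ρ) := by have := ht.1; have := hρ.1; positivity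
  have hlt : f t ρ < 0 := by linarith
  refine ⟨η, hη, t, ht.1.lt_of_ne ?_, ρ, hρ.1.lt_of_ne ?_, hlt, fun s hs σ hσ => ?_⟩
  · rintro rfl; exact (hinit ρ hρ.1).not_gt hlt
  · rintro rfl; exact (hbdry t ht.1).not_gt hlt
  · by_cases hL : s ≤ L ∧ σ ≤ L
    · exact hmin (show (s, σ) ∈ (Icc 0 L ×ˢ Icc 0 L : Set (ℝ × ℝ)) from ⟨⟨hs, hL.1⟩, ⟨hσ, hL.2⟩⟩)
    · have h1 : L ≤ s + σ := by
        by_contra! h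
        exact hL ⟨by linarith, by linarith⟩
      have h2 := hB s hs σ hσ
      have h3 := neg_abs_le B
      have h4 : η * L ≤ η * (s + σ) := by gcongr
      linarith

/-- `φ` is (Fréchet) differentiable on the open quadrant, with `φ_t = a` and `φ_ρ = b`. It is stated
on `EuclideanSpace ℝ (Fin 2)`, where the Fréchet sub- and superdifferentials live. -/
def HasQuadrantPartials (φ a b : ℝ → ℝ → ℝ) : Prop :=
  ∀ t > 0, ∀ ρ > 0, HasFDerivAt (fun z : EuclideanSpace ℝ (Fin 2) => φ (z 0) (z 1))
    (innerSL ℝ !₂[a t ρ, b t ρ]) !₂[t, ρ]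

theorem HasQuadrantPartials.add_linear {φ a b : ℝ → ℝ → ℝ} (h : HasQuadrantPartials φ a b)
    (η : ℝ) : HasQuadrantPartials (fun t ρ => φ t ρ + η * (t + ρ))
      (fun t ρ => a t ρ + η) (fun t ρ => b t ρ + η) := by
  intro t ht ρ hρ
  have h0 := (EuclideanSpace.proj 0 : EuclideanSpace ℝ (Fin 2) →L[ℝ] ℝ).hasFDerivAt
    (x := !₂[t, ρ])
  have h1 := (EuclideanSpace.proj 1 : EuclideanSpace ℝ (Fin 2) →L[ℝ] ℝ).hasFDerivAt
    (x := !₂[t, ρ])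
  refine ((h t ht ρ hρ).add ((h0.add h1).const_mul η)).congr_fderiv ?_
  ext v
  simp [PiLp.inner_apply, Fin.sum_univ_two]
  ring

theorem eventually_quadrant {t ρ : ℝ} (ht : 0 < t) (hρ : 0 < ρ) :
    ∀ᶠ z : EuclideanSpace ℝ (Fin 2) in 𝓝 !₂[t, ρ], 0 ≤ z 0 ∧ 0 ≤ z 1 := by
  have h0 : Tendsto (fun z : EuclideanSpace ℝ (Fin 2) => z 0) (𝓝 !₂[t, ρ]) (𝓝 t) :=
    Continuous.tendsto (by fun_prop) _
  have h1 : Tendsto (fun z : EuclideanSpace ℝ (Fin 2) => z 1) (𝓝 !₂[t, ρ]) (𝓝 ρ) :=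
    Continuous.tendsto (by fun_prop) _
  filter_upwards [h0.eventually (lt_mem_nhds ht), h1.eventually (lt_mem_nhds hρ)] with z hz hz'
  exact ⟨hz.le, hz'.le⟩

/-- A supersolution that is bounded below stays above every classical subsolution that is bounded
above. Only the positive part of `φ` multiplies the slope term: a negative `φ` may be steep. -/
theorem IsViscositySupersolution.ge_of_classical {α : ℝ} (hα : 0 ≤ α) {m₀ : ℝ → ℝ}
    {m φ a b : ℝ → ℝ → ℝ} (hm : IsViscositySupersolution α m₀ m) {B : ℝ}
    (hB : ∀ t ≥ 0, ∀ ρ ≥ 0, B ≤ m t ρ - φ t ρ)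
    (hφ : ContinuousOn (Function.uncurry φ) (Ici 0 ×ˢ Ici 0)) (hd : HasQuadrantPartials φ a b)
    (heq : ∀ t > 0, ∀ ρ > 0, a t ρ + (max (b t ρ) 0) ^ α * max (φ t ρ) 0 ≤ 0)
    (hinit : ∀ ρ ≥ 0, φ 0 ρ ≤ m 0 ρ) (hbdry : ∀ t ≥ 0, φ t 0 ≤ m t 0) {t ρ : ℝ}
    (ht : 0 ≤ t) (hρ : 0 ≤ ρ) : φ t ρ ≤ m t ρ := by
  by_contra! hlt
  obtain ⟨η, hη, s, hs, σ, hσ, hneg, hmin⟩ := exists_interior_min_add_linear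
    (f := fun t ρ => m t ρ - φ t ρ) (hm.continuousOn.sub hφ) hB
    (fun ρ hρ => sub_nonneg.2 (hinit ρ hρ)) (fun t ht => sub_nonneg.2 (hbdry t ht)) ht hρ
    (by linarith)
  have hloc : IsLocalMin (fun z : EuclideanSpace ℝ (Fin 2) =>
      m (z 0) (z 1) - (φ (z 0) (z 1) + -η * (z 0 + z 1))) !₂[s, σ] := by
    filter_upwards [eventually_quadrant hs hσ] with z hz
    have := hmin (z 0) hz.1 (z 1) hz.2
    simp only [Matrix.cons_val_zero, Matrix.cons_val_one]
    linarith
  have hp := hm.equation s hs σ hσ _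
    (mem_frechetSubdiff_of_isLocalMin_sub hloc (hd.add_linear (-η) s hs σ hσ))
  simp only [Matrix.cons_val_zero, Matrix.cons_val_one] at hp
  have h1 : (max (b s σ + -η) 0) ^ α * m s σ ≤ (max (b s σ) 0) ^ α * max (φ s σ) 0 := by
    calc _ ≤ (max (b s σ + -η) 0) ^ α * max (φ s σ) 0 := by
          gcongr
          exact le_max_of_le_left (by linarith)
      _ ≤ _ := by
          gcongr
          linarith
  linarith [heq s hs σ hσ]

/-- A subsolution that is bounded above stays below every nonnegative classical supersolution. -/
theorem IsViscositySubsolution.le_of_classical {α : ℝ} (hα : 0 ≤ α) {m₀ : ℝ → ℝ}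
    {m φ a b : ℝ → ℝ → ℝ} (hm : IsViscositySubsolution α m₀ m) {B : ℝ}
    (hB : ∀ t ≥ 0, ∀ ρ ≥ 0, m t ρ ≤ B) (hpos : ∀ t ≥ 0, ∀ ρ ≥ 0, 0 ≤ φ t ρ)
    (hφ : ContinuousOn (Function.uncurry φ) (Ici 0 ×ˢ Ici 0)) (hd : HasQuadrantPartials φ a b)
    (heq : ∀ t > 0, ∀ ρ > 0, 0 ≤ a t ρ + (max (b t ρ) 0) ^ α * φ t ρ)
    (hinit : ∀ ρ ≥ 0, m 0 ρ ≤ φ 0 ρ) (hbdry : ∀ t ≥ 0, m t 0 ≤ φ t 0) {t ρ : ℝ}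
    (ht : 0 ≤ t) (hρ : 0 ≤ ρ) : m t ρ ≤ φ t ρ := by
  by_contra! hlt
  obtain ⟨η, hη, s, hs, σ, hσ, hneg, hmin⟩ := exists_interior_min_add_linear
    (f := fun t ρ => φ t ρ - m t ρ) (hφ.sub hm.continuousOn) (B := -B)
    (fun t ht ρ hρ => by linarith [hB t ht ρ hρ, hpos t ht ρ hρ])
    (fun ρ hρ => sub_nonneg.2 (hinit ρ hρ)) (fun t ht => sub_nonneg.2 (hbdry t ht)) ht hρ
    (by linarith)
  have hloc : IsLocalMax (fun z : EuclideanSpace ℝ (Fin 2) =>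
      m (z 0) (z 1) - (φ (z 0) (z 1) + η * (z 0 + z 1))) !₂[s, σ] := by
    filter_upwards [eventually_quadrant hs hσ] with z hz
    have := hmin (z 0) hz.1 (z 1) hz.2
    simp only [Matrix.cons_val_zero, Matrix.cons_val_one]
    linarith
  have hp := hm.equation s hs σ hσ _
    (mem_frechetSuperdiff_of_isLocalMax_sub hloc (hd.add_linear η s hs σ hσ))
  simp only [Matrix.cons_val_zero, Matrix.cons_val_one] at hp
  have h1 : (max (b s σ) 0) ^ α * φ s σ ≤ (max (b s σ + η) 0) ^ α * m s σ := by
    have := hpos s hs.le σ hσ.le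
    gcongr
    · linarith
    · linarith
  linarith [heq s hs σ hσ]

theorem HasQuadrantPartials.const (c : ℝ) :
    HasQuadrantPartials (fun _ _ => c) (fun _ _ => 0) (fun _ _ => 0) := by
  intro t ht ρ hρ
  refine (hasFDerivAt_const c _).congr_fderiv ?_
  ext v
  simp [PiLp.inner_apply, Fin.sum_univ_two]

/-- The form shared by both barriers: `φ t ρ = k + u t * v (r + c t + l ρ)`. -/
theorem HasQuadrantPartials.add_mul_comp {u v u' v' : ℝ → ℝ} (k c : ℝ) (r : ℝ) (l : ℝ)
    (hu : ∀ t > 0, HasDerivAt u (u' t) t) (hv : ∀ x, HasDerivAt v (v' x) x) :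
    HasQuadrantPartials (fun t ρ => k + u t * v (r + c * t + l * ρ))
      (fun t ρ => u' t * v (r + c * t + l * ρ) + u t * (v' (r + c * t + l * ρ) * c))
      (fun t ρ => u t * (v' (r + c * t + l * ρ) * l)) := by
  intro t ht ρ hρ
  have h0 := (EuclideanSpace.proj 0 : EuclideanSpace ℝ (Fin 2) →L[ℝ] ℝ).hasFDerivAt
    (x := !₂[t, ρ])
  have h1 := (EuclideanSpace.proj 1 : EuclideanSpace ℝ (Fin 2) →L[ℝ] ℝ).hasFDerivAt
    (x := !₂[t, ρ])
  have hlin := ((h0.const_mul c).const_add r).add (h1.const_mul l)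
  have h2 := (hu t ht).comp_hasFDerivAt_of_eq !₂[t, ρ] h0 (by simp)
  have h3 := (hv (r + c * t + l * ρ)).comp_hasFDerivAt_of_eq !₂[t, ρ] hlin (by simp)
  refine ((h2.mul h3).const_add k).congr_fderiv ?_
  ext w
  simp [PiLp.inner_apply, Fin.sum_univ_two]
  ring

/-! ### Distributional derivatives on the half-line -/

/-- The hypothesis concerns positive `x` only, as test functions on the open half-line see nothing
else; `b` may be negative. -/
theorem isVanishingOn_distribDeriv_Ioi {f : ℝ → ℝ} {b K : ℝ} (h : ∀ x > 0, b < x → f x = K) :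
    Distribution.IsVanishingOn (distribDeriv f) (Ioi b) := by
  intro φ hφ
  have h0 : ∀ ρ ∈ Ioi (0 : ℝ), f ρ * deriv (φ : ℝ → ℝ) ρ = K * deriv (φ : ℝ → ℝ) ρ := by
    intro ρ hρ
    by_cases hb : b < ρ
    · rw [h ρ hρ hb]
    · rw [image_eq_zero_of_notMem_tsupport fun hmem => hb (hφ (tsupport_deriv_subset hmem))]
      simp
  have h1 : (φ : ℝ → ℝ) 0 = 0 := image_eq_zero_of_notMem_tsupport fun hmem =>
    lt_irrefl (0 : ℝ) (φ.tsupport_subset hmem)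
  rw [distribDeriv, setIntegral_congr_fun measurableSet_Ioi h0, integral_const_mul,
    φ.hasCompactSupport.integral_Ioi_deriv_eq (φ.contDiff.of_le (by simp)) 0, h1]
  simp

theorem densitySupport_subset_Iic {f : ℝ → ℝ} {b K : ℝ} (h : ∀ x > 0, b < x → f x = K) :
    densitySupport f ⊆ Iic b := by
  intro x hx
  by_contra hb
  exact disjoint_left.1 ((isVanishingOn_distribDeriv_Ioi h).disjoint_dsupport isOpen_Ioi)
    (show b < x from lt_of_not_ge hb) hx

/-- A smooth function with compact support in an interval and mean zero has a smooth primitive with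
compact support in the same interval. -/
theorem exists_testFunction_deriv_eq {p q : ℝ} (hp : 0 ≤ p) {g : ℝ → ℝ} (hg : ContDiff ℝ ∞ g)
    (hc : HasCompactSupport g) (hs : tsupport g ⊆ Ioo p q) (hint : ∫ x, g x = 0) :
    ∃ φ : 𝓓(openHalfLine, ℝ), tsupport φ ⊆ Ioo p q ∧ deriv (φ : ℝ → ℝ) = g := by
  rcases (tsupport g).eq_empty_or_nonempty with he | hne
  · have hg0 : g = 0 := tsupport_eq_empty_iff.1 he
    exact ⟨0, by simp, by rw [hg0]; ext; simp⟩
  have hc' : IsCompact (tsupport g) := hc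
  obtain ⟨c, hcm, hcl⟩ := hc'.exists_isLeast hne
  obtain ⟨d, hdm, hdu⟩ := hc'.exists_isGreatest hne
  have hpc := (hs hcm).1
  have hdq := (hs hdm).2
  obtain ⟨c', hpc', hcc'⟩ := exists_between hpc
  have hzero : ∀ x, x ∉ Icc c d → g x = 0 := fun x hx =>
    image_eq_zero_of_notMem_tsupport fun hmem => hx ⟨hcl hmem, hdu hmem⟩
  let Φ : ℝ → ℝ := fun x => ∫ s in c'..x, g s
  have hderiv : deriv Φ = g := funext fun x => hg.continuous.deriv_integral _ _ _
  have hdiff : Differentiable ℝ Φ := fun x =>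
    (hg.continuous.integral_hasStrictDerivAt c' x).hasDerivAt.differentiableAt
  have hsupp : Function.support Φ ⊆ Icc c d := by
    intro x hx
    by_contra hn
    refine hx ?_
    rw [mem_Icc, not_and_or, not_le, not_le] at hn
    rcases hn with hn | hn
    · refine intervalIntegral.integral_zero_ae (ae_of_all _ fun y hy => hzero y fun hy' => ?_)
      have := (mem_uIoc.1 hy)
      rcases this with h | h <;> linarith [hy'.1]
    · change (∫ s in c'..x, g s) = 0
      rw [intervalIntegral.integral_eq_integral_of_support_subset, hint]
      intro y hy
      have : y ∈ tsupport g := subset_tsupport g hy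
      exact ⟨hcc'.trans_le (hcl this), (hdu this).trans hn.le⟩
  have hts : tsupport Φ ⊆ Icc c d := closure_minimal hsupp isClosed_Icc
  have hpq : tsupport Φ ⊆ Ioo p q := hts.trans (Icc_subset_Ioo hpc hdq)
  refine ⟨⟨Φ, ?_, isCompact_Icc.of_isClosed_subset (isClosed_tsupport _) hts,
    fun x hx => hp.trans_lt (hpq hx).1⟩, hpq, hderiv⟩
  exact contDiff_infty_iff_deriv.2 ⟨hdiff, hderiv ▸ hg⟩

/-- The du Bois-Reymond lemma for continuous functions. -/
theorem exists_eq_const_of_isVanishingOn {f : ℝ → ℝ} {p q : ℝ} (hp : 0 ≤ p) (hpq : p < q)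
    (hf : ContinuousOn f (Ioo p q)) (h : Distribution.IsVanishingOn (distribDeriv f) (Ioo p q)) :
    ∃ K, ∀ x ∈ Ioo p q, f x = K := by
  -- a reference bump of integral one: `g - (∫ g) ψ` has mean zero, hence is a derivative
  obtain ⟨ψ, hψ1, hψ2, hψ3, hψ4⟩ : ∃ ψ : ℝ → ℝ, ContDiff ℝ ∞ ψ ∧ HasCompactSupport ψ ∧
      tsupport ψ ⊆ Ioo p q ∧ ∫ x, ψ x = 1 := by
    let χ : ContDiffBump ((p + q) / 2) :=
      ⟨(q - p) / 8, (q - p) / 4, by linarith, by linarith⟩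
    refine ⟨χ.normed volume, χ.contDiff_normed, χ.hasCompactSupport_normed, ?_, χ.integral_normed⟩
    rw [χ.tsupport_normed_eq, Real.closedBall_eq_Icc]
    apply Icc_subset_Ioo <;> simp only [χ] <;> linarith
  -- `f` need not be measurable outside `(p, q)`, but `f * g` vanishes there
  have hint : ∀ g : ℝ → ℝ, Continuous g → HasCompactSupport g → tsupport g ⊆ Ioo p q →
      Integrable (fun x => f x * g x) := by
    intro g hg hgc hgs
    have hc : Continuous (fun x => f x * g x) := by
      refine continuous_iff_continuousAt.2 fun x => ?_
      by_cases hx : x ∈ tsupport g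
      · exact (hf.continuousAt (isOpen_Ioo.mem_nhds (hgs hx))).mul hg.continuousAt
      · have : (fun x => f x * g x) =ᶠ[𝓝 x] fun _ => 0 := by
          filter_upwards [(isClosed_tsupport g).isOpen_compl.mem_nhds hx] with y hy
          rw [image_eq_zero_of_notMem_tsupport hy, mul_zero]
        exact continuousAt_const.congr this.symm
    exact hc.integrable_of_hasCompactSupport hgc.mul_left
  have hkey : ∀ g : ℝ → ℝ, ContDiff ℝ ∞ g → HasCompactSupport g → tsupport g ⊆ Ioo p q →
      ∫ x, f x * g x = (∫ x, f x * ψ x) * ∫ x, g x := by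
    intro g hg hgc hgs
    set I := ∫ x, g x with hI
    have hsub : tsupport (fun x => g x - I * ψ x) ⊆ tsupport g ∪ tsupport ψ :=
      (tsupport_sub g _).trans (union_subset_union_right _
        (tsupport_smul_subset_right (fun _ => I) ψ))
    obtain ⟨φ, hφs, hφ⟩ := exists_testFunction_deriv_eq (g := fun x => g x - I * ψ x) hp
      (hg.sub (contDiff_const.mul hψ1)) (hgc.sub hψ2.mul_left)
      (hsub.trans (union_subset hgs hψ3)) (by
        rw [integral_sub (hg.continuous.integrable_of_hasCompactSupport hgc)
          ((hψ1.continuous.integrable_of_hasCompactSupport hψ2).const_mul I),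
          integral_const_mul, hψ4, ← hI]
        ring)
    have h0 := h φ hφs
    rw [distribDeriv, neg_eq_zero, hφ, setIntegral_eq_integral_of_forall_compl_eq_zero] at h0
    · have : (fun x => f x * (g x - I * ψ x)) = fun x => f x * g x - I * (f x * ψ x) := by
        ext x; ring
      rw [this, integral_sub (hint g hg.continuous hgc hgs)
        ((hint ψ hψ1.continuous hψ2 hψ3).const_mul I), integral_const_mul] at h0
      linarith
    · intro x hx
      have h1 : ∀ g : ℝ → ℝ, tsupport g ⊆ Ioo p q → g x = 0 := fun g hg =>
        image_eq_zero_of_notMem_tsupport fun hmem => hx (hp.trans_lt (hg hmem).1)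
      simp [h1 g hgs, h1 ψ hψ3]
  set K := ∫ x, f x * ψ x
  have hae : ∀ᵐ x, x ∈ Ioo p q → f x - K = 0 := by
    refine isOpen_Ioo.ae_eq_zero_of_integral_contDiff_smul_eq_zero
      ((hf.sub continuousOn_const).locallyIntegrableOn measurableSet_Ioo) fun g hg hgc hgs => ?_
    have : (fun x => g x • (f x - K)) = fun x => f x * g x - K * g x := by
      ext x; simp only [smul_eq_mul]; ring
    rw [this, integral_sub (hint g hg.continuous hgc hgs)
      ((hg.continuous.integrable_of_hasCompactSupport hgc).const_mul K), integral_const_mul,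
      hkey g hg hgc hgs, sub_self]
  refine ⟨K, Measure.eqOn_open_of_ae_eq (μ := volume) (g := fun _ => K) ?_ isOpen_Ioo hf
    continuousOn_const⟩
  rw [EventuallyEq, ae_restrict_iff' measurableSet_Ioo]
  filter_upwards [hae] with x hx hmem
  linarith [hx hmem]

theorem exists_eq_const_of_disjoint_densitySupport {f : ℝ → ℝ} {a : ℝ} (ha : 0 ≤ a)
    (hf : ContinuousOn f (Ioi a)) (hd : Disjoint (Ioi a) (densitySupport f)) :
    ∃ K, ∀ x > a, f x = K := by
  have hloc : ∀ x ∈ Ioi a, HasDerivAt f 0 x := by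
    intro x hx
    obtain ⟨s, hs, hso, hxs⟩ := (Distribution.notMem_dsupport_iff x).1 (disjoint_left.1 hd hx)
    obtain ⟨p, q, hxpq, hsub⟩ := mem_nhds_iff_exists_Ioo_subset.1
      ((hso.inter isOpen_Ioi).mem_nhds ⟨hxs, hx⟩)
    have hap : a ≤ p := by
      by_contra! hlt
      have hm : max p a < x := max_lt hxpq.1 hx
      obtain ⟨y, hy⟩ : (Ioo p (min x a)).Nonempty :=
        nonempty_Ioo.2 (lt_min hxpq.1 hlt)
      have : a < y := (hsub ⟨hy.1, (hy.2.trans_le (min_le_left _ _)).trans hxpq.2⟩).2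
      linarith [hy.2.trans_le (min_le_right _ _)]
    obtain ⟨K, hK⟩ := exists_eq_const_of_isVanishingOn (ha.trans hap) (hxpq.1.trans hxpq.2)
      (hf.mono fun y hy => (hsub hy).2) (hs.mono fun y hy => (hsub hy).1)
    refine (hasDerivAt_const x K).congr_of_eventuallyEq ?_
    filter_upwards [isOpen_Ioo.mem_nhds hxpq] with y hy using hK y hy
  refine ⟨f (a + 1), fun x hx => ?_⟩
  exact isOpen_Ioi.is_const_of_deriv_eq_zero isPreconnected_Ioi
    (fun y hy => (hloc y hy).differentiableAt.differentiableWithinAt)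
    (fun y hy => (hloc y hy).deriv) hx (by simp)

/-! ### Explicit barriers -/

theorem hasDerivAt_max_zero_rpow {β : ℝ} (hβ : 1 < β) (x : ℝ) :
    HasDerivAt (fun y : ℝ => (max y 0) ^ β) (β * (max x 0) ^ (β - 1)) x := by
  have hβ0 : β ≠ 0 := by linarith
  have hβ1 : β - 1 ≠ 0 := by linarith
  rcases lt_trichotomy x 0 with hx | rfl | hx
  · rw [max_eq_right hx.le, Real.zero_rpow hβ1, mul_zero]
    refine (hasDerivAt_const x (0 : ℝ)).congr_of_eventuallyEq ?_
    filter_upwards [gt_mem_nhds hx] with y hy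
    rw [max_eq_right hy.le, Real.zero_rpow hβ0]
  · rw [max_self, ← hasDerivWithinAt_univ, ← Iic_union_Ici (a := (0 : ℝ))]
    refine HasDerivWithinAt.union ?_ ?_
    · rw [Real.zero_rpow hβ1, mul_zero]
      refine (hasDerivWithinAt_const (0 : ℝ) _ (0 : ℝ)).congr (fun y hy => ?_) ?_
      · rw [max_eq_right hy, Real.zero_rpow hβ0]
      · rw [max_self, Real.zero_rpow hβ0]
    · refine (Real.hasDerivAt_rpow_const (Or.inr hβ.le)).hasDerivWithinAt.congr (fun y hy => ?_) ?_
      · rw [max_eq_left hy]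
      · rw [max_self]
  · rw [max_eq_left hx.le]
    refine (Real.hasDerivAt_rpow_const (Or.inr hβ.le)).congr_of_eventuallyEq ?_
    filter_upwards [lt_mem_nhds hx] with y hy
    rw [max_eq_left hy.le]

theorem continuous_max_zero_rpow {β : ℝ} (hβ : 1 < β) :
    Continuous (fun y : ℝ => (max y 0) ^ β) :=
  continuous_iff_continuousAt.2 fun x => (hasDerivAt_max_zero_rpow hβ x).continuousAt

/-- Neither the initial nor the boundary condition covers the corner `(0, 0)`; it is reached along the
edge `ρ = 0`. -/
theorem tendsto_corner {m : ℝ → ℝ → ℝ}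
    (hm : ContinuousOn (Function.uncurry m) (Ici 0 ×ˢ Ici 0)) :
    Tendsto (fun t => m t 0) (𝓝[>] 0) (𝓝 (m 0 0)) := by
  have h : Tendsto (fun t : ℝ => (t, (0 : ℝ))) (𝓝[>] 0) (𝓝[Ici 0 ×ˢ Ici 0] (0, 0)) := by
    refine tendsto_nhdsWithin_iff.2 ⟨?_, ?_⟩
    · exact (Continuous.tendsto (by fun_prop) (0 : ℝ)).mono_left nhdsWithin_le_nhds
    · filter_upwards [self_mem_nhdsWithin] with t ht
      exact ⟨Ioi_subset_Ici_self ht, self_mem_Ici⟩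
  exact Tendsto.comp (hm (0, 0) ⟨self_mem_Ici, self_mem_Ici⟩) h

theorem IsViscositySubsolution.edge_nonpos {α : ℝ} {m₀ : ℝ → ℝ} {m : ℝ → ℝ → ℝ}
    (hm : IsViscositySubsolution α m₀ m) {t : ℝ} (ht : 0 ≤ t) : m t 0 ≤ 0 := by
  rcases ht.eq_or_lt with rfl | ht
  · refine le_of_tendsto (tendsto_corner hm.continuousOn) ?_
    filter_upwards [self_mem_nhdsWithin] with t ht using hm.boundary t ht
  · exact hm.boundary t ht

theorem IsViscositySupersolution.edge_nonneg {α : ℝ} {m₀ : ℝ → ℝ} {m : ℝ → ℝ → ℝ}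
    (hm : IsViscositySupersolution α m₀ m) {t : ℝ} (ht : 0 ≤ t) : 0 ≤ m t 0 := by
  rcases ht.eq_or_lt with rfl | ht
  · refine ge_of_tendsto (tendsto_corner hm.continuousOn) ?_
    filter_upwards [self_mem_nhdsWithin] with t ht using hm.boundary t ht
  · exact hm.boundary t ht

/-- Comparison with the Hopf–Lax profile `W = b + C (t + ε) ^ (1 - β) (ρ - r)₊ ^ β`. Since
`(β - 1) * α = β`, both `W_t` and `W_ρ ^ α` are multiples of `(t + ε) ^ (-β) (ρ - r)₊ ^ β`, and `hC`
says that `W_t + b W_ρ ^ α ≥ 0`; then `W ≥ b` makes `W` a supersolution. The head start `ε > 0` avoids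
the singularity at `t = 0`. -/
theorem IsViscositySubsolution.le_hopfLax {α β : ℝ} (hα : 1 < α) (hβ : β = α / (α - 1))
    {m₀ : ℝ → ℝ} {m : ℝ → ℝ → ℝ} (hm : IsViscositySubsolution α m₀ m) {B : ℝ}
    (hB : ∀ t ≥ 0, ∀ ρ ≥ 0, m t ρ ≤ B) {b C r ε : ℝ} (hb : 0 ≤ b) (hC0 : 0 ≤ C)
    (hC : C * (β - 1) ≤ b * (C ^ α * β ^ α)) (hε : 0 < ε)
    (hinit : ∀ ρ ≥ 0, m 0 ρ ≤ b + C * ε ^ (1 - β) * (max (ρ - r) 0) ^ β) {t ρ : ℝ}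
    (ht : 0 ≤ t) (hρ : 0 ≤ ρ) :
    m t ρ ≤ b + C * (t + ε) ^ (1 - β) * (max (ρ - r) 0) ^ β := by
  have hα1 : 0 < α - 1 := by linarith
  have hβ1 : 1 < β := by rw [hβ, lt_div_iff₀ hα1]; linarith
  have hβα : (β - 1) * α = β := by rw [hβ]; field_simp; ring
  have hu : ∀ t > 0, HasDerivAt (fun t => C * (t + ε) ^ (1 - β))
      (C * ((1 - β) * (t + ε) ^ (-β))) t := by
    intro t ht
    refine (((hasDerivAt_id t).add_const ε).rpow_const (p := 1 - β)
      (Or.inl (by simp only [id]; linarith)) |>.const_mul C).congr_deriv ?_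
    rw [show 1 - β - 1 = -β by ring]
    simp
  have hd := HasQuadrantPartials.add_mul_comp b 0 (-r) 1 hu (hasDerivAt_max_zero_rpow hβ1)
  have hx : ∀ t ρ : ℝ, -r + 0 * t + 1 * ρ = ρ - r := fun t ρ => by ring
  simp only [hx] at hd
  have hpos : ∀ t ≥ 0, ∀ ρ : ℝ, 0 ≤ C * (t + ε) ^ (1 - β) * (max (ρ - r) 0) ^ β := by
    intro t ht ρ
    have : 0 ≤ t + ε := by linarith
    positivity
  refine hm.le_of_classical (by linarith) hB (fun t ht ρ _ => add_nonneg hb (hpos t ht ρ)) ?_ hd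
    ?_ (by simpa only [zero_add] using hinit) (fun t ht => (hm.edge_nonpos ht).trans (add_nonneg hb (hpos t ht 0))) ht hρ
  · refine continuousOn_const.add (ContinuousOn.mul (ContinuousOn.mul continuousOn_const ?_) ?_)
    · refine ContinuousOn.rpow_const (by fun_prop) fun z hz => Or.inl ?_
      have : 0 ≤ z.1 := hz.1
      linarith
    · exact ((continuous_max_zero_rpow hβ1).comp
        (f := fun z : ℝ × ℝ => z.2 - r) (by fun_prop)).continuousOn
  · intro t ht ρ hρ
    have hs : 0 < t + ε := by linarith
    set s := t + ε
    set z := max (ρ - r) 0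
    have hz : 0 ≤ z := le_max_right _ _
    have hslope : (max (C * s ^ (1 - β) * (β * z ^ (β - 1) * 1)) 0) ^ α
        = C ^ α * β ^ α * (s ^ (-β) * z ^ β) := by
      have hβ0 : 0 ≤ β := by linarith
      rw [max_eq_left (by positivity), mul_one, Real.mul_rpow (by positivity) (by positivity),
        Real.mul_rpow hC0 (by positivity), Real.mul_rpow hβ0 (by positivity),
        ← Real.rpow_mul hs.le, ← Real.rpow_mul hz, hβα,
        show (1 - β) * α = -β by linarith]
      ring
    rw [hslope]
    have hQ : 0 ≤ s ^ (-β) * z ^ β := by positivity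
    have hβ0 : 0 ≤ β := by linarith
    have h1 : C ^ α * β ^ α * (s ^ (-β) * z ^ β) * b
        ≤ C ^ α * β ^ α * (s ^ (-β) * z ^ β) * (b + C * s ^ (1 - β) * z ^ β) := by
      gcongr
      have := hpos t ht.le ρ
      linarith
    have h2 := mul_le_mul_of_nonneg_right hC hQ
    linarith

/-- Lower barrier `M - M (c + 1 + v t - ρ)₊ ^ 2` with speed `v = (2 M) ^ α / 2`: finite speed of
propagation. It is positive only where `(c + 1 + v t - ρ)₊ < 1`, and there its slope to the power `α`
is at most `(2 M) ^ α (c + 1 + v t - ρ)₊`, which the speed `v` compensates. -/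
theorem IsViscositySupersolution.mass_le_of_le {α : ℝ} (hα : 1 < α) {m₀ : ℝ → ℝ} {m : ℝ → ℝ → ℝ}
    (hm : IsViscositySupersolution α m₀ m) {B : ℝ} (hB : ∀ t ≥ 0, ∀ ρ ≥ 0, B ≤ m t ρ)
    {M c : ℝ} (hM : 0 ≤ M) (hc : 0 ≤ c) (hpos : ∀ ρ ≥ 0, 0 ≤ m 0 ρ)
    (hfull : ∀ ρ > c, M ≤ m 0 ρ) {t ρ : ℝ} (ht : 0 ≤ t)
    (hρ : c + 1 + (2 * M) ^ α / 2 * t ≤ ρ) : M ≤ m t ρ := by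
  set v := (2 * M) ^ α / 2 with hv
  have hv0 : 0 ≤ v := by positivity
  have hd := HasQuadrantPartials.add_mul_comp M v (c + 1) (-1) (u := fun _ => -M)
    (u' := fun _ => 0) (fun t _ => hasDerivAt_const t (-M))
    (hasDerivAt_max_zero_rpow (β := 2) (by norm_num))
  have hle : ∀ x : ℝ, M + -M * (max x 0) ^ (2 : ℝ) ≤ M := by
    intro x
    have : 0 ≤ M * (max x 0) ^ (2 : ℝ) := by positivity
    linarith
  have hle0 : ∀ x : ℝ, 1 ≤ x → M + -M * (max x 0) ^ (2 : ℝ) ≤ 0 := by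
    intro x hx
    have h1 : 1 ≤ (max x 0) ^ (2 : ℝ) :=
      Real.one_le_rpow (hx.trans (le_max_left _ _)) (by norm_num)
    nlinarith
  have hvt : 0 ≤ v * t := by positivity
  have key := hm.ge_of_classical (by linarith) (B := B - M)
    (fun t ht ρ hρ => by linarith [hB t ht ρ hρ, hle (c + 1 + v * t + -1 * ρ)]) ?_ hd ?_ ?_ ?_
    ht (show 0 ≤ ρ by linarith)
  · refine le_trans (le_of_eq ?_) key
    rw [max_eq_right (by linarith), Real.zero_rpow (by norm_num)]
    ring
  · refine continuousOn_const.add (ContinuousOn.mul continuousOn_const ?_)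
    exact ((continuous_max_zero_rpow (β := 2) (by norm_num)).comp
      (f := fun z : ℝ × ℝ => c + 1 + v * z.1 + -1 * z.2) (by fun_prop)).continuousOn
  · intro t ht ρ hρ
    set x := c + 1 + v * t + -1 * ρ
    rcases le_or_gt x 1 with hx | hx
    · set z := max x 0 with hz
      have hz0 : 0 ≤ z := le_max_right _ _
      have hz1 : z ≤ 1 := max_le hx zero_le_one
      have hslope : (max (-M * (2 * z ^ ((2 : ℝ) - 1) * -1)) 0) ^ α ≤ (2 * M) ^ α * z := by
        rw [show (2 : ℝ) - 1 = 1 by norm_num, Real.rpow_one,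
          show -M * (2 * z * -1) = 2 * M * z by ring, max_eq_left (by positivity),
          Real.mul_rpow (by positivity) hz0]
        gcongr
        exact (Real.rpow_le_rpow_of_exponent_ge' hz0 hz1 zero_le_one hα.le).trans_eq
          (Real.rpow_one z)
      have h1 : (max (-M * (2 * z ^ ((2 : ℝ) - 1) * -1)) 0) ^ α
          * max (M + -M * z ^ (2 : ℝ)) 0 ≤ (2 * M) ^ α * z * M := by
        gcongr
        exact max_le (hle x) hM
      refine (add_le_add_right h1 _).trans (le_of_eq ?_)
      rw [show (2 : ℝ) - 1 = 1 by norm_num, Real.rpow_one, hv]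
      ring
    · rw [max_eq_right (hle0 x hx.le), mul_zero, zero_mul, zero_add, add_zero]
      have : 0 ≤ M * (2 * (max x 0) ^ ((2 : ℝ) - 1) * v) := by positivity
      linarith
  · intro ρ hρ
    rcases le_or_gt ρ c with h | h
    · exact (hle0 _ (by linarith)).trans (hpos ρ hρ)
    · exact (hle _).trans (hfull ρ h)
  · intro t ht
    have : 0 ≤ v * t := by positivity
    exact (hle0 _ (by linarith)).trans (hm.edge_nonneg ht)

/-- The left side is linear in `C` and the right side has the power `α > 1`. -/
theorem exists_hopfLax_constant {α β μ : ℝ} (hα : 1 < α) (hβ : 0 < β) (hμ : 0 < μ) :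
    ∃ C > 0, C * (β - 1) ≤ μ * (C ^ α * β ^ α) := by
  have h1 := (tendsto_rpow_atTop (y := α - 1) (by linarith)).eventually_ge_atTop
    ((β - 1) / (μ * β ^ α))
  obtain ⟨C, hC, hC0⟩ := (h1.and (eventually_gt_atTop 0)).exists
  refine ⟨C, hC0, ?_⟩
  rw [div_le_iff₀ (by positivity)] at hC
  have h2 : C ^ α = C ^ (α - 1) * C := by
    rw [← Real.rpow_add_one hC0.ne', sub_add_cancel]
  rw [h2]
  nlinarith

/-! ### No waiting time -/

/-- Under `hgap`, the jump from `m₀ r` to `M` exceeds what the Hopf–Lax barrier issued at `r` gains over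
the distance `c - r` by time `t`, so full mass is not reached at `c`. -/
theorem lt_mass_of_large_gap {α β : ℝ} (hα : 1 < α) (hβ : β = α / (α - 1))
    {m₀ : ℝ → ℝ} {m : ℝ → ℝ → ℝ} (hm : IsViscositySubsolution α m₀ m) {M : ℝ}
    (hM : ∀ t ≥ 0, ∀ ρ ≥ 0, m t ρ ≤ M) (hcont : ContinuousOn m₀ (Ici 0))
    (hmono : MonotoneOn m₀ (Ici 0)) (hinit : ∀ ρ ≥ 0, m 0 ρ ≤ m₀ ρ) {r c μ C t : ℝ} (hr : 0 ≤ r)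
    (hrc : r ≤ c) (hμ : 0 < μ) (hμr : μ ≤ m₀ r) (hC0 : 0 < C)
    (hC : C * (β - 1) ≤ μ * (C ^ α * β ^ α)) (ht : 0 < t)
    (hgap : C * t ^ (1 - β) * (c - r) ^ β < M - m₀ r) : m t c < M := by
  have hα1 : 0 < α - 1 := by linarith
  have hβ1 : 1 < β := by rw [hβ, lt_div_iff₀ hα1]; linarith
  obtain ⟨b, hb, hbM⟩ := exists_between (show m₀ r < M - C * t ^ (1 - β) * (c - r) ^ β by linarith)
  -- by continuity the datum stays below `b` a little beyond `r`
  obtain ⟨δ, hδ, hδb⟩ : ∃ δ > 0, ∀ ρ ≥ 0, ρ ≤ r + δ → m₀ ρ ≤ b := by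
    obtain ⟨δ, hδ, h⟩ := Metric.mem_nhdsWithin_iff.1 ((hcont r hr).eventually (gt_mem_nhds hb))
    refine ⟨δ / 2, by positivity, fun ρ hρ hle => ?_⟩
    have h0 : (0 : ℝ) ≤ r + δ / 2 := by positivity
    refine (hmono hρ h0 hle).trans (le_of_lt (h ⟨?_, h0⟩))
    rw [Metric.mem_ball, Real.dist_eq, add_sub_cancel_left, abs_of_pos (by positivity)]
    linarith
  -- beyond that, a short head start `ε` makes the barrier exceed `M`
  obtain ⟨ε, hε, hεM⟩ : ∃ ε > 0, M ≤ C * ε ^ (1 - β) * δ ^ β := by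
    have h1 := (tendsto_rpow_atTop (y := β - 1) (by linarith)).eventually_ge_atTop
      (M / (C * δ ^ β))
    obtain ⟨x, hx, hx0⟩ := (h1.and (eventually_gt_atTop 0)).exists
    refine ⟨x⁻¹, by positivity, ?_⟩
    rw [Real.inv_rpow hx0.le, ← Real.rpow_neg hx0.le, neg_sub]
    rw [div_le_iff₀ (by positivity)] at hx
    linarith
  have hb0 : 0 ≤ b := by linarith
  have hβ0 : 0 < β := by linarith
  have hcmp := hm.le_hopfLax hα hβ hM hb0 hC0.le
    (hC.trans (mul_le_mul_of_nonneg_right (by linarith) (by positivity))) hε (r := r) (fun ρ hρ => by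
      have hz : 0 ≤ max (ρ - r) 0 := le_max_right _ _
      rcases le_or_gt ρ (r + δ) with h | h
      · have : 0 ≤ C * ε ^ (1 - β) * (max (ρ - r) 0) ^ β := by positivity
        linarith [hinit ρ hρ, hδb ρ hρ h]
      · have : C * ε ^ (1 - β) * δ ^ β ≤ C * ε ^ (1 - β) * (max (ρ - r) 0) ^ β := by
          gcongr
          exact le_max_of_le_left (by linarith)
        linarith [hM 0 le_rfl ρ hρ]) ht.le (hr.trans hrc)
  rw [max_eq_left (by linarith)] at hcmp
  have hdec : (t + ε) ^ (1 - β) ≤ t ^ (1 - β) :=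
    Real.rpow_le_rpow_of_nonpos ht (by linarith) (by linarith)
  have hcr : 0 ≤ c - r := by linarith
  have : C * (t + ε) ^ (1 - β) * (c - r) ^ β ≤ C * t ^ (1 - β) * (c - r) ^ β := by gcongr
  linarith

/-- Beyond the support of its derivative, a monotone function equals its supremum. -/
theorem eq_sup_of_isGreatest_densitySupport {f : ℝ → ℝ} (hf : ContinuousOn f (Ici 0))
    (hmono : MonotoneOn f (Ici 0)) {M c : ℝ} (hM : IsLUB (f '' Ici 0) M)
    (hc : IsGreatest (densitySupport f) c) : 0 < c ∧ ∀ ρ ≥ c, f ρ = M := by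
  obtain ⟨K, hK⟩ := exists_eq_const_of_disjoint_densitySupport (a := max c 0) (le_max_right _ _)
    (hf.mono fun x hx => ((le_max_right c 0).trans_lt hx).le)
    (disjoint_left.2 fun x hx hx' => ((le_max_left c 0).trans_lt hx).not_ge (hc.2 hx'))
  have hc0 : 0 < c := by
    by_contra! h
    -- `f` is constant on the whole open half-line, so its derivative has empty support
    rw [max_eq_right h] at hK
    have := densitySupport_subset_Iic (f := f) (b := c - 1) (K := K) (fun x hx _ => hK x hx) hc.1
    simp only [mem_Iic] at this
    linarith
  rw [max_eq_left hc0.le] at hK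
  have hKM : K = M := by
    refine le_antisymm ?_ ?_
    · rw [← hK (c + 1) (by simp)]
      exact hM.1 ⟨c + 1, by simp only [mem_Ici]; linarith, rfl⟩
    · refine hM.2 ?_
      rintro _ ⟨x, hx, rfl⟩
      have h1 : x ≤ max x (c + 1) := le_max_left _ _
      have h2 : c < max x (c + 1) := lt_max_of_lt_right (by linarith)
      rw [← hK _ h2]
      exact hmono hx (le_trans hx h1) h1
  subst hKM
  refine ⟨hc0, fun ρ hρ => ?_⟩
  rcases hρ.eq_or_lt with rfl | hρ
  · refine tendsto_nhds_unique
      (((hf.continuousAt (Ici_mem_nhds hc0)).mono_left nhdsWithin_le_nhds) :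
        Tendsto f (𝓝[>] c) (𝓝 (f c))) (tendsto_const_nhds.congr' ?_)
    filter_upwards [self_mem_nhdsWithin] with y hy using (hK y hy).symm
  · exact hK ρ hρ

theorem mainTheorem1 (α : ℝ) (hα : 1 < α)
    (m₀ : ℝ → ℝ) (hBUC : IsBUCOn m₀ (Ici 0)) (hmono : MonotoneOn m₀ (Ici 0)) (hzero : m₀ 0 = 0)
    (M : ℝ) (hM : IsLUB (m₀ '' Ici 0) M)
    (c₀ : ℝ) (hc₀ : IsGreatest (densitySupport m₀) c₀)
    (hlimsup : limsup
      (fun ρ => (((M - m₀ ρ) / (c₀ - ρ) ^ (α / (α - 1)) : ℝ) : EReal)) (𝓝[<] c₀) = ⊤)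
    (m : ℝ → ℝ → ℝ) (hm : IsViscositySolution α m₀ m)
    (hmBUC : IsBUCOn (Function.uncurry m) (Ici 0 ×ˢ Ici 0)) :
    ∀ t > 0, ∃ S : ℝ, IsGreatest (densitySupport (m t)) S ∧ c₀ < S := by
  intro t ht
  obtain ⟨hsub, hsup⟩ := hm
  have hcont₀ : ContinuousOn m₀ (Ici 0) := hBUC.1.continuousOn
  obtain ⟨hc₀pos, hfull⟩ := eq_sup_of_isGreatest_densitySupport hcont₀ hmono hM hc₀
  obtain ⟨B, hB⟩ := hmBUC.2
  have hBle : ∀ t ≥ 0, ∀ ρ ≥ 0, m t ρ ≤ B := fun t ht ρ hρ => (abs_le.1 (hB (t, ρ) ⟨ht, hρ⟩)).2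
  have hBge : ∀ t ≥ 0, ∀ ρ ≥ 0, -B ≤ m t ρ := fun t ht ρ hρ => (abs_le.1 (hB (t, ρ) ⟨ht, hρ⟩)).1
  have hm₀M : ∀ ρ ≥ 0, m₀ ρ ≤ M := fun ρ hρ => hM.1 ⟨ρ, hρ, rfl⟩
  have hm₀0 : ∀ ρ ≥ 0, 0 ≤ m₀ ρ := fun ρ hρ => hzero ▸ hmono self_mem_Ici hρ hρ
  have hM0 : 0 < M := by
    refine lt_of_le_of_ne ((hm₀0 0 le_rfl).trans (hm₀M 0 le_rfl)) ?_
    rintro rfl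
    have := densitySupport_subset_Iic (f := m₀) (b := c₀ - 1) (K := 0)
      (fun x hx _ => le_antisymm (hm₀M x hx.le) (hm₀0 x hx.le)) hc₀.1
    simp only [mem_Iic] at this
    linarith
  have hinit_le : ∀ ρ ≥ 0, m 0 ρ ≤ m₀ ρ := by
    intro ρ hρ
    rcases hρ.eq_or_lt with rfl | hρ
    · rw [hzero]; exact hsub.edge_nonpos le_rfl
    · exact hsub.initial ρ hρ
  have hinit_ge : ∀ ρ ≥ 0, m₀ ρ ≤ m 0 ρ := by
    intro ρ hρ
    rcases hρ.eq_or_lt with rfl | hρ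
    · rw [hzero]; exact hsup.edge_nonneg le_rfl
    · exact hsup.initial ρ hρ
  have hmM : ∀ t ≥ 0, ∀ ρ ≥ 0, m t ρ ≤ M := fun t ht ρ hρ =>
    hsub.le_of_classical (by linarith) hBle (fun _ _ _ _ => hM0.le) continuousOn_const
      (HasQuadrantPartials.const M)
      (fun _ _ _ _ => by
        rw [max_self, Real.zero_rpow (by linarith)]; simp)
      (fun ρ hρ => (hinit_le ρ hρ).trans (hm₀M ρ hρ))
      (fun t ht => (hsub.edge_nonpos ht).trans hM0.le) ht hρ
  -- finite speed of propagation
  set R := c₀ + 1 + (2 * M) ^ α / 2 * t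
  have hRpos : 0 ≤ (2 * M) ^ α / 2 * t := by positivity
  have hfar : ∀ ρ ≥ R, m t ρ = M := fun ρ hρ =>
    le_antisymm (hmM t ht.le ρ (by simp only [R] at hρ; linarith))
      (hsup.mass_le_of_le hα hBge hM0.le hc₀pos.le
        (fun ρ hρ => (hm₀0 ρ hρ).trans (hinit_ge ρ hρ))
        (fun ρ hρ => (hfull ρ hρ.le).symm.le.trans (hinit_ge ρ (hc₀pos.trans hρ).le)) ht.le hρ)
  have hbdd : densitySupport (m t) ⊆ Iic R :=
    densitySupport_subset_Iic fun x _ hx => hfar x hx.le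
  -- the front has left `c₀`
  have hα1 : 0 < α - 1 := by linarith
  have hstrict : m t c₀ < M := by
    set β := α / (α - 1) with hβ
    have hβ0 : 0 < β := by positivity
    obtain ⟨C, hC0, hC⟩ := exists_hopfLax_constant hα hβ0 (half_pos hM0)
    have hfreq := frequently_lt_of_lt_limsup (b := ((C * t ^ (1 - β) : ℝ) : EReal))
      (by isBoundedDefault) (hlimsup ▸ EReal.coe_lt_top _)
    have hnear : ∀ᶠ ρ in 𝓝[<] c₀, M / 2 < m₀ ρ :=
      nhdsWithin_le_nhds ((hcont₀.continuousAt (Ici_mem_nhds hc₀pos)).eventually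
        (lt_mem_nhds (by rw [hfull c₀ le_rfl]; linarith)))
    have hpos : ∀ᶠ ρ in 𝓝[<] c₀, 0 < ρ := nhdsWithin_le_nhds (lt_mem_nhds hc₀pos)
    obtain ⟨r, hr, hr1, hr2, hr3⟩ := (hfreq.and_eventually (hnear.and
      (hpos.and self_mem_nhdsWithin))).exists
    have hr3 : r < c₀ := hr3
    have hd : 0 < c₀ - r := by linarith
    rw [EReal.coe_lt_coe_iff, lt_div_iff₀ (by positivity)] at hr
    exact lt_mass_of_large_gap hα hβ hsub hmM hcont₀ hmono hinit_le hr2.le hr3.le (half_pos hM0)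
      hr1.le hC0 hC ht hr
  have hcont : ContinuousOn (m t) (Ici 0) :=
    hsub.continuousOn.comp (f := fun ρ : ℝ => (t, ρ)) (by fun_prop) fun ρ hρ => ⟨ht.le, hρ⟩
  obtain ⟨s, hs, hcs⟩ : ∃ s ∈ densitySupport (m t), c₀ < s := by
    by_contra! hno
    obtain ⟨K, hK⟩ := exists_eq_const_of_disjoint_densitySupport hc₀pos.le
      (hcont.mono fun x hx => (hc₀pos.trans hx).le)
      (disjoint_left.2 fun x hx hx' => (hno x hx').not_gt hx)
    have hKM : K = M := by
      rw [← hK R (by simp only [R]; linarith), hfar R le_rfl]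
    refine hstrict.ne (tendsto_nhds_unique
      (((hcont.continuousAt (Ici_mem_nhds hc₀pos)).mono_left nhdsWithin_le_nhds) :
        Tendsto (m t) (𝓝[>] c₀) (𝓝 (m t c₀))) (tendsto_const_nhds.congr' ?_))
    filter_upwards [self_mem_nhdsWithin] with y hy
    rw [hK y hy, hKM]
  have hba : BddAbove (densitySupport (m t)) := ⟨R, hbdd⟩
  exact ⟨sSup (densitySupport (m t)),
    ⟨Distribution.isClosed_dsupport.csSup_mem ⟨s, hs⟩ hba, fun x hx => le_csSup hba hx⟩,
    hcs.trans_le (le_csSup hba hs)⟩
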